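/- Let $H_1=\mathbb R^3$ be the Heisenberg group with contact form $\Theta=dz+x\,dy-y\,dx$, contact planes $\xi=\ker\Theta$, left invariant fields $\mathring e_1=\partial_x+y\,\partial_z$, $\mathring e_2=\partial_y-x\,\partial_z$, $T=\partial_z$, the metric for which $\mathring e_1,\mathring e_2,T$ are orthonormal, the connection $\nabla$ for which they are parallel, and the endomorphism $J$ of $\xi$ with $J\mathring e_1=\mathring e_2$, $J\mathring e_2=-\mathring e_1$. A Heisenberg rigid motion is a $C^\infty$ diffeomorphism of $H_1$ preserving $\Theta$ and $J$. Let $\Sigma\subset H_1$ be a $C^\infty$ embedded surface without boundary. A point $p\in\Sigma$ is singular if $T_p\Sigma=\xi_p$ and regular otherwise. Near a regular point there is, up to sign, a unique smooth unit field $e_1$ in $T\Sigma\cap\xi$; put $e_2=Je_1$. The $p$-mean curvature $H$ is defined by $\nabla_{e_1}e_2=-He_1$, and $\Sigma$ is called $p$-minimal if $H=0$ at all its regular points. The function $\alpha$ on the regular part is defined by $\alpha e_2+T\in T\Sigma$. Near a regular point $q$, the surface is of special type I with $\zeta_1$-invariant $\zeta_1$ if around $q$ there are local coordinates $(x,y)$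 of $\Sigma$ with $$e_1=\frac{\partial}{\partial x},\qquad \alpha=\frac1{x+\zeta_1(y)},\qquad \frac{\alpha e_2+T}{\sqrt{1+\alpha^2}}=\frac{\alpha^2}{\sqrt{1+\alpha^2}}\,\frac{\partial}{\partial y}.$$ **Theorem.** Let $\Sigma\subset H_1$ be a $p$-minimal surface and let $S$ be the set of its singular points. 1. Each connected component of $S$ is relatively open in $S$, and it is either a single point (which is then an isolated point of $S$) or an embedded $C^1$ curve without end points. 2. A point $p\in H_1$ is an isolated point of $S$ if and only if there are an open neighbourhood $W$ of $p$ and a Heisenberg rigid motion $\Phi$ with $\Phi(p)=0$ such that, for every $q\in W$, $q\in\Sigma$ if and only if $\Phi(q)$ lies in the plane $\{z=0\}$ (that is, near $p$ the surface is congruent to a piece of the graph $u=0$, with $p$ corresponding to the origin). 3. If $p$ is an isolated point of $S$, then there are an open neighbourhood $W$ of $p$ and a constant $c$ such that, near each point of $(\Sigma\cap W)\setminus\{p\}$, the surface is of special type I with constant $\zeta_1$-invariant $\zeta_1\equiv c$. -/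

import Mathlib

open Set Topology
open scoped ContDiff

/-- The underlying space of the Heisenberg group, with coordinates `(x, y, z)`. -/
abbrev Heis : Type := ℝ × ℝ × ℝ

namespace Heis

/-- The contact form `Θ = dz + x dy - y dx` at the point `p`, applied to the vector `v`. -/
def contactForm (p v : Heis) : ℝ := v.2.2 + p.1 * v.2.1 - p.2.1 * v.1

/-- The left invariant field `∂/∂x + y ∂/∂z`. -/
def frame1 (p : Heis) : Heis := (1, 0, p.2.1)

/-- The left invariant field `∂/∂y - x ∂/∂z`. -/
def frame2 (p : Heis) : Heis := (0, 1, -p.1)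

/-- The field `T = ∂/∂z`. -/
def reeb : Heis := (0, 0, 1)

/-- The contact plane `ξ_p = ker Θ_p`, spanned by `frame1 p` and `frame2 p`. -/
def contactPlane (p : Heis) : Set Heis := {v | contactForm p v = 0}

/-- The CR structure `J`: it sends `a frame1 + b frame2` to `-b frame1 + a frame2`
(it is only used on the contact plane; it is extended by `J T = 0`). -/
def crJ (p v : Heis) : Heis := (-v.2.1) • frame1 p + v.1 • frame2 p

/-- The adapted metric, for which `frame1`, `frame2`, `T` are orthonormal. The coefficients of `v`
in this frame are `v.1`, `v.2.1` and `Θ_p(v)`. -/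
def metric (p v w : Heis) : ℝ :=
  v.1 * w.1 + v.2.1 * w.2.1 + contactForm p v * contactForm p w

/-- The covariant derivative at `p`, in the direction `v`, of the vector field `Y`, for the connection
that makes `frame1`, `frame2`, `T` parallel. -/
noncomputable def covDeriv (Y : Heis → Heis) (p v : Heis) : Heis :=
  (fderiv ℝ (fun q => (Y q).1) p v) • frame1 p
    + (fderiv ℝ (fun q => (Y q).2.1) p v) • frame2 p
    + (fderiv ℝ (fun q => contactForm q (Y q)) p v) • reeb

/-- Heisenberg rigid motions (pseudohermitian transformations): diffeomorphisms of the whole space that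
preserve `Θ` and `J`. -/
structure IsRigidMotion (Φ : Heis ≃ Heis) : Prop where
  smooth : ContDiff ℝ ∞ Φ
  smooth_symm : ContDiff ℝ ∞ Φ.symm
  preserves_contactForm : ∀ p v, contactForm (Φ p) (fderiv ℝ Φ p v) = contactForm p v
  preserves_crJ : ∀ p, ∀ v ∈ contactPlane p,
    fderiv ℝ Φ p (crJ p v) = crJ (Φ p) (fderiv ℝ Φ p v)

/-- `X : U → S` is a smooth local parametrization (chart inverse) of the set `S`. -/
structure IsLocalParam (S : Set Heis) (U : Set (ℝ × ℝ)) (X : ℝ × ℝ → Heis) : Prop where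
  isOpen : IsOpen U
  smooth : ContDiffOn ℝ ∞ X U
  immersion : ∀ q ∈ U, Function.Injective (fderiv ℝ X q)
  embedding : IsEmbedding (U.domRestrict X)
  image : ∃ W : Set Heis, IsOpen W ∧ X '' U = S ∩ W

/-- `S` is a smooth (embedded) surface without boundary. -/
def IsSurface (S : Set Heis) : Prop :=
  ∀ p ∈ S, ∃ (U : Set (ℝ × ℝ)) (X : ℝ × ℝ → Heis), IsLocalParam S U X ∧ p ∈ X '' U

/-- Tangent vectors of `S` at `p`: velocities at time `0` of curves in `S` through `p`. -/
def tangentVectors (S : Set Heis) (p : Heis) : Set Heis :=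
  {v | ∃ γ : ℝ → Heis, γ 0 = p ∧ (∀ᶠ t in 𝓝 (0 : ℝ), γ t ∈ S) ∧ HasDerivAt γ v 0}

/-- The set of singular points: the tangent plane coincides with the contact plane. -/
def singularSet (S : Set Heis) : Set Heis :=
  {p | p ∈ S ∧ tangentVectors S p = contactPlane p}

/-- `E` is a smooth field on the open set `W` whose restriction to `S ∩ W` is a unit field
in `TS ∩ ξ` (a characteristic direction `e₁`). -/
structure IsCharField (S W : Set Heis) (E : Heis → Heis) : Prop where
  isOpen : IsOpen W
  smooth : ContDiffOn ℝ ∞ E W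
  tangent : ∀ q ∈ S ∩ W, E q ∈ tangentVectors S q
  horizontal : ∀ q ∈ S ∩ W, E q ∈ contactPlane q
  unit : ∀ q ∈ S ∩ W, metric q (E q) (E q) = 1

/-- The p-mean curvature of `S` at the regular point `p` is `H`: with `e₂ = J e₁`, one has
`∇_{e₁} e₂ = -H e₁` at `p`. (`e₁` is unique up to sign, so `H` is determined up to sign; the left
side depends on `e₁` along `S` only, since `e₁` is tangent to `S`.) -/
def HasPMeanCurvature (S : Set Heis) (p : Heis) (H : ℝ) : Prop :=
  ∃ (W : Set Heis) (E : Heis → Heis), p ∈ W ∧ IsCharField S W E ∧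
    covDeriv (fun q => crJ q (E q)) p (E p) = -(H • E p)

/-- p-minimal surfaces: smooth surfaces with `H = 0` at every regular point. -/
structure IsPMinimal (S : Set Heis) : Prop where
  surface : IsSurface S
  curvature : ∀ p ∈ S, p ∉ singularSet S → HasPMeanCurvature S p 0

/-- `p` is an isolated point of the singular set of `S`. -/
def IsIsolatedSingularPoint (S : Set Heis) (p : Heis) : Prop :=
  ∃ W : Set Heis, IsOpen W ∧ singularSet S ∩ W = {p}

/-- `C` is an embedded `C¹` curve (a one-dimensional `C¹` submanifold, without end points). -/
def IsC1Curve (C : Set Heis) : Prop :=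
  ∀ p ∈ C, ∃ (W : Set Heis) (ε : ℝ) (γ : ℝ → Heis), IsOpen W ∧ 0 < ε ∧ γ 0 = p ∧
    ContDiffOn ℝ 1 γ (Ioo (-ε) ε) ∧ (∀ t ∈ Ioo (-ε) ε, deriv γ t ≠ 0) ∧
    IsEmbedding ((Ioo (-ε) ε).domRestrict γ) ∧ γ '' Ioo (-ε) ε = C ∩ W

/-- The coordinate vector fields `X_x`, `X_y` of a parametrization. -/
noncomputable def partialX (X : ℝ × ℝ → Heis) (q : ℝ × ℝ) : Heis := fderiv ℝ X q (1, 0)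

noncomputable def partialY (X : ℝ × ℝ → Heis) (q : ℝ × ℝ) : Heis := fderiv ℝ X q (0, 1)

/-- Compatible coordinates: `∂/∂x` is a characteristic direction `e₁`. -/
structure IsCompatible (S : Set Heis) (U : Set (ℝ × ℝ)) (X : ℝ × ℝ → Heis) : Prop where
  param : IsLocalParam S U X
  horizontal : ∀ q ∈ U, partialX X q ∈ contactPlane (X q)
  unit : ∀ q ∈ U, metric (X q) (partialX X q) (partialX X q) = 1

/-- `α` is the α-function in compatible coordinates: `α e₂ + T` is tangent to `S`, where `e₂ = J e₁`
and `e₁ = X_x`. -/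
def IsAlphaFunction (S : Set Heis) (U : Set (ℝ × ℝ)) (X : ℝ × ℝ → Heis) (α : ℝ × ℝ → ℝ) : Prop :=
  ∀ q ∈ U, α q • crJ (X q) (partialX X q) + reeb ∈ tangentVectors S (X q)

/-- The functions `a`, `b` representing the induced metric in compatible coordinates:
`(α e₂ + T) / √(1 + α²) = a X_x + b X_y`. -/
def IsMetricRep (U : Set (ℝ × ℝ)) (X : ℝ × ℝ → Heis) (α a b : ℝ × ℝ → ℝ) : Prop :=
  ∀ q ∈ U, (√(1 + α q ^ 2))⁻¹ • (α q • crJ (X q) (partialX X q) + reeb)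
    = a q • partialX X q + b q • partialY X q

/-- The function `1 / (x + ζ(y))`. -/
noncomputable def alphaI (ζ : ℝ → ℝ) (q : ℝ × ℝ) : ℝ := 1 / (q.1 + ζ q.2)

/-- Near the point `p`, the surface `S` is of special type I with `ζ₁`-invariant `ζ`: there is a normal
coordinate system around `p` in which `α = 1 / (x + ζ(y))`, `a = 0` and `b = α² / √(1 + α²)`. -/
def IsSpecialTypeIAt (S : Set Heis) (p : Heis) (ζ : ℝ → ℝ) : Prop :=
  ∃ (U : Set (ℝ × ℝ)) (X : ℝ × ℝ → Heis), p ∈ X '' U ∧ IsCompatible S U X ∧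
    (∀ q ∈ U, ContDiffAt ℝ ∞ ζ q.2 ∧ q.1 + ζ q.2 ≠ 0) ∧
    IsAlphaFunction S U X (alphaI ζ) ∧
    IsMetricRep U X (alphaI ζ) (fun _ => 0)
      (fun q => alphaI ζ q ^ 2 / √(1 + alphaI ζ q ^ 2))

/-- Near `p`, the surface `S` is congruent to a piece of the graph `u = 0`, with `p` corresponding to
the origin. -/
def IsPlanePieceAt (S : Set Heis) (p : Heis) : Prop :=
  ∃ (Φ : Heis ≃ Heis) (W : Set Heis), IsRigidMotion Φ ∧ IsOpen W ∧ p ∈ W ∧ Φ p = 0 ∧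
    ∀ q ∈ W, q ∈ S ↔ (Φ q).2.2 = 0

end Heis

/-! Near a singular point the tangent plane is the contact plane, which contains no vertical vector,
so the surface is a graph `z = u(x, y)`. Put `G = charDir u`. On the tangent vector of the graph
over `a`, the contact form equals `cross G a`. Thus `G` spans the projected characteristic direction
at regular points, and the singular points are the zeros of `G`. Two facts drive everything: the
divergence of `G` is `2` (`charDir_trace`), and p-minimality makes the characteristic curves
straight, `cross G (DG(G)) = 0` (`cross_charDir_eq_zero`).

Let `G` vanish at `w₀` and let `A` be its derivative there. If some `v` is not an eigenvector of
`A`, then `cross v G = 0` is a smooth curve near `w₀`. On it `G = c v`, and straightness forces `c =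
0`, so this curve is the whole singular set (`isArcAt`). Otherwise `A` is scalar, and trace `2`
makes it the identity. Then all characteristic lines near `w₀` pass through `w₀`
(`eventually_cross_sub_eq_zero`), and integrating along rays shows that the graph is the contact
plane at the point (`eventually_eq_affine`).

A left translation carries that plane to `z = 0`, whose only singular point is the origin, and polar
coordinates exhibit special type I. The statement on components follows from this dichotomy by
point-set topology. -/

namespace Heis

/-! ### Surfaces as graphs near singular points. -/

/-- The projection of the Heisenberg group onto the `xy`-plane. -/
noncomputable def proj : Heis →L[ℝ] ℝ × ℝ :=
  (ContinuousLinearMap.fst ℝ ℝ (ℝ × ℝ)).prod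
    ((ContinuousLinearMap.fst ℝ ℝ ℝ).comp (ContinuousLinearMap.snd ℝ ℝ (ℝ × ℝ)))

@[simp] lemma proj_apply (q : Heis) : proj q = (q.1, q.2.1) := rfl

/-- The cross product of two plane vectors. -/
def cross (a b : ℝ × ℝ) : ℝ := a.1 * b.2 - a.2 * b.1

/-- The (unnormalised) characteristic direction of the graph of `u`, projected to the plane. -/
noncomputable def charDir (u : ℝ × ℝ → ℝ) (w : ℝ × ℝ) : ℝ × ℝ :=
  (fderiv ℝ u w (0, 1) + w.1, w.2 - fderiv ℝ u w (1, 0))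

/-- In the open set `W`, the set `S` is the graph of the smooth function `u` over `Ω`. -/
structure IsGraphOn (S W : Set Heis) (Ω : Set (ℝ × ℝ)) (u : ℝ × ℝ → ℝ) : Prop where
  isOpen : IsOpen W
  isOpen_base : IsOpen Ω
  smooth : ContDiffOn ℝ ∞ u Ω
  proj_mem : ∀ q ∈ W, proj q ∈ Ω
  mem_iff : ∀ q ∈ W, q ∈ S ↔ q.2.2 = u (proj q)
  lift_mem : ∀ w ∈ Ω, ((w.1, w.2, u w) : Heis) ∈ W

/-- The inverse function theorem for smooth maps of an open set, with injective derivative. -/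
lemma exists_openPartialHomeomorph {E : Type*} [NormedAddCommGroup E] [NormedSpace ℝ E]
    [FiniteDimensional ℝ E] {f : E → E} {U : Set E} {a : E} (hU : IsOpen U)
    (hf : ContDiffOn ℝ ∞ f U) (ha : a ∈ U) (hinj : Function.Injective (fderiv ℝ f a)) :
    ∃ e : OpenPartialHomeomorph E E, ⇑e = f ∧ a ∈ e.source ∧ e.source ⊆ U ∧
      ContDiffOn ℝ ∞ e.symm e.target := by
  have : CompleteSpace E := FiniteDimensional.complete ℝ E
  have key : ∀ b ∈ U, Function.Injective (fderiv ℝ f b) →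
      ∃ f' : E ≃L[ℝ] E, HasFDerivAt f (f' : E →L[ℝ] E) b := by
    intro b hb hinj
    have hd : DifferentiableAt ℝ f b :=
      (hf.contDiffAt (hU.mem_nhds hb)).differentiableAt (by simp)
    let L : E ≃ₗ[ℝ] E := LinearEquiv.ofInjectiveEndo (fderiv ℝ f b : E →ₗ[ℝ] E) hinj
    refine ⟨L.toContinuousLinearEquiv, ?_⟩
    have : (L.toContinuousLinearEquiv : E →L[ℝ] E) = fderiv ℝ f b := by
      ext x
      rfl
    rw [this]
    exact hd.hasFDerivAt
  obtain ⟨f', hf'⟩ := key a ha hinj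
  have hfa := hf.contDiffAt (hU.mem_nhds ha)
  let e₀ := hfa.toOpenPartialHomeomorph f hf' (by simp)
  have hcont : ContinuousOn (fderiv ℝ f) U := hf.continuousOn_fderiv_of_isOpen hU (by simp)
  -- Keeping only points with injective derivative makes the inverse smooth on its whole target, not
  -- just at the image of `a`.
  have hO : IsOpen (U ∩ fderiv ℝ f ⁻¹' {L | Function.Injective L}) :=
    hcont.isOpen_inter_preimage hU ContinuousLinearMap.isOpen_injective
  refine ⟨e₀.restrOpen _ hO, rfl, ⟨hfa.mem_toOpenPartialHomeomorph_source hf' (by simp), ha, hinj⟩,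
    fun b hb => hb.2.1, fun c hc => ?_⟩
  have hs := (e₀.restrOpen _ hO).map_target hc
  obtain ⟨g', hg'⟩ := key _ hs.2.1 hs.2.2
  exact ((e₀.restrOpen _ hO).contDiffAt_symm hc hg'
    (hf.contDiffAt (hU.mem_nhds hs.2.1))).contDiffWithinAt

/-- Since `X` is an embedding, it is open onto its image; this allows shrinking a parametrization to
the domain given by the inverse function theorem. -/
lemma IsLocalParam.exists_image {S : Set Heis} {U V : Set (ℝ × ℝ)} {X : ℝ × ℝ → Heis}
    (h : IsLocalParam S U X) (hV : IsOpen V) (hVU : V ⊆ U) :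
    ∃ W : Set Heis, IsOpen W ∧ X '' V = S ∩ W := by
  obtain ⟨W₀, hW₀, him⟩ := h.image
  obtain ⟨W₁, hW₁, h₁⟩ := h.embedding.isOpen_iff.1 (hV.preimage continuous_subtype_val : IsOpen
    ((↑) ⁻¹' V : Set U))
  have h₂ : ∀ a (ha : a ∈ U), X a ∈ W₁ ↔ a ∈ V := fun a ha => Set.ext_iff.1 h₁ ⟨a, ha⟩
  refine ⟨W₀ ∩ W₁, hW₀.inter hW₁, ?_⟩
  rw [← inter_assoc, ← him]
  ext q
  constructor
  · rintro ⟨a, ha, rfl⟩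
    exact ⟨⟨a, hVU ha, rfl⟩, (h₂ a (hVU ha)).2 ha⟩
  · rintro ⟨⟨a, ha, rfl⟩, h'⟩
    exact ⟨a, (h₂ a ha).1 h', rfl⟩

lemma IsLocalParam.fderiv_mem_tangentVectors {S : Set Heis} {U : Set (ℝ × ℝ)} {X : ℝ × ℝ → Heis}
    (h : IsLocalParam S U X) {a : ℝ × ℝ} (ha : a ∈ U) (w : ℝ × ℝ) :
    fderiv ℝ X a w ∈ tangentVectors S (X a) := by
  have hd : HasFDerivAt X (fderiv ℝ X a) a :=
    ((h.smooth.contDiffAt (h.isOpen.mem_nhds ha)).differentiableAt (by simp)).hasFDerivAt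
  have hl : HasDerivAt (fun t : ℝ => a + t • w) w 0 := by
    simpa using ((hasDerivAt_id (0 : ℝ)).smul_const w).const_add a
  refine ⟨fun t => X (a + t • w), by simp, ?_, ?_⟩
  · have : ∀ᶠ t in 𝓝 (0 : ℝ), a + t • w ∈ U :=
      hl.continuousAt.eventually_mem (h.isOpen.mem_nhds (by simpa using ha))
    obtain ⟨W, -, hW⟩ := h.image
    filter_upwards [this] with t ht
    exact (hW.subset ⟨_, ht, rfl⟩).1
  · have hd' : HasFDerivAt X (fderiv ℝ X a) (a + (0 : ℝ) • w) := by simpa using hd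
    exact hd'.comp_hasDerivAt (0 : ℝ) hl

/-- Near a singular point, a surface is a graph over the `xy`-plane. -/
lemma exists_isGraphOn {S : Set Heis} (hS : IsSurface S) {p : Heis} (hp : p ∈ singularSet S) :
    ∃ W Ω u, p ∈ W ∧ IsGraphOn S W Ω u := by
  obtain ⟨U, X, hX, a, ha, rfl⟩ := hS p hp.1
  have hd : HasFDerivAt X (fderiv ℝ X a) a :=
    ((hX.smooth.contDiffAt (hX.isOpen.mem_nhds ha)).differentiableAt (by simp)).hasFDerivAt
  have hf : ContDiffOn ℝ ∞ (fun b => proj (X b)) U := proj.contDiff.comp_contDiffOn hX.smooth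
  have hinj : Function.Injective (fderiv ℝ (fun b => proj (X b)) a) := by
    have hfd : fderiv ℝ (fun b => proj (X b)) a = proj.comp (fderiv ℝ X a) :=
      (proj.hasFDerivAt.comp a hd).fderiv
    rw [hfd, injective_iff_map_eq_zero]
    intro w hw
    have h₁ : contactForm (X a) (fderiv ℝ X a w) = 0 := by
      have := hX.fderiv_mem_tangentVectors ha w
      rwa [hp.2] at this
    simp only [ContinuousLinearMap.comp_apply, proj_apply, Prod.mk_eq_zero] at hw
    -- A vertical vector in the contact plane is zero.
    have h₂ : fderiv ℝ X a w = 0 := by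
      simp only [contactForm, hw.1, hw.2] at h₁
      ext <;> simp [hw.1, hw.2] <;> linarith
    exact hX.immersion a ha (by simpa using h₂)
  obtain ⟨e, he, hae, heU, hsymm⟩ := exists_openPartialHomeomorph hX.isOpen hf ha hinj
  obtain ⟨W, hW, hXW⟩ := hX.exists_image e.open_source heU
  have hproj : ∀ b, proj (X b) = e b := fun b => by rw [he]
  refine ⟨W ∩ proj ⁻¹' e.target, e.target, fun w => (X (e.symm w)).2.2, ⟨?_, ?_⟩, ?_⟩
  · exact (hXW.subset ⟨a, hae, rfl⟩).2
  · rw [mem_preimage, hproj]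
    exact e.map_source hae
  have hlift : ∀ w ∈ e.target, ((w.1, w.2, (X (e.symm w)).2.2) : Heis) = X (e.symm w) := by
    intro w hw
    have := hproj (e.symm w)
    rw [e.right_inv hw] at this
    exact Prod.ext (congrArg Prod.fst this).symm (Prod.ext (congrArg Prod.snd this).symm rfl)
  refine ⟨hW.inter (e.open_target.preimage proj.continuous), e.open_target, ?_, fun q hq => hq.2,
    fun q hq => ⟨fun hqS => ?_, fun hq' => ?_⟩, fun w hw => ⟨?_, hw⟩⟩
  · exact contDiff_snd.comp_contDiffOn (contDiff_snd.comp_contDiffOn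
      (hX.smooth.comp hsymm fun w hw => heU (e.map_target hw)))
  · obtain ⟨b, hb, rfl⟩ := hXW.superset ⟨hqS, hq.1⟩
    simp only [hproj, e.left_inv hb]
  · have := hlift _ hq.2
    rw [← hq', proj_apply] at this
    have h₂ := hXW.subset ⟨_, e.map_target hq.2, rfl⟩
    rw [proj_apply, ← this] at h₂
    exact h₂.1
  · rw [hlift w hw]
    exact (hXW.subset ⟨_, e.map_target hw, rfl⟩).2

/-! ### Tangent planes, singular points and the p-minimal equation of a graph. -/

namespace IsGraphOn

variable {S W : Set Heis} {Ω : Set (ℝ × ℝ)} {u : ℝ × ℝ → ℝ}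

lemma contDiffAt (h : IsGraphOn S W Ω u) {w : ℝ × ℝ} (hw : w ∈ Ω) : ContDiffAt ℝ ∞ u w :=
  h.smooth.contDiffAt (h.isOpen_base.mem_nhds hw)

lemma hasFDerivAt (h : IsGraphOn S W Ω u) {w : ℝ × ℝ} (hw : w ∈ Ω) :
    HasFDerivAt u (fderiv ℝ u w) w :=
  ((h.contDiffAt hw).differentiableAt (by simp)).hasFDerivAt

lemma mem_of_lift (h : IsGraphOn S W Ω u) {w : ℝ × ℝ} (hw : w ∈ Ω) :
    ((w.1, w.2, u w) : Heis) ∈ S := by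
  rw [h.mem_iff _ (h.lift_mem w hw)]
  simp

lemma mem_tangentVectors_iff (h : IsGraphOn S W Ω u) {q : Heis} (hq : q ∈ W) (hqS : q ∈ S)
    (v : Heis) : v ∈ tangentVectors S q ↔ v.2.2 = fderiv ℝ u (proj q) (proj v) := by
  have hz := (h.mem_iff q hq).1 hqS
  have hu := h.hasFDerivAt (h.proj_mem q hq)
  constructor
  · rintro ⟨γ, hγ0, hγS, hγ⟩
    have h₁ : HasDerivAt (fun t => (γ t).2.2) v.2.2 0 := hγ.snd.snd
    have h₂ : HasDerivAt (fun t => proj (γ t)) (proj v) 0 := proj.hasFDerivAt.comp_hasDerivAt 0 hγ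
    rw [← hγ0] at hu hq
    have h₃ := hu.comp_hasDerivAt (0 : ℝ) h₂
    have h₄ : (fun t => (γ t).2.2) =ᶠ[𝓝 0] u ∘ fun t => proj (γ t) := by
      filter_upwards [hγS, hγ.continuousAt.eventually_mem (h.isOpen.mem_nhds hq)] with t h₁ h₂
      exact (h.mem_iff _ h₂).1 h₁
    rw [← hγ0]
    exact h₁.unique (h₃.congr_of_eventuallyEq h₄)
  · intro hv
    have hl : HasDerivAt (fun t : ℝ => proj q + t • proj v) (proj v) 0 := by
      simpa using ((hasDerivAt_id (0 : ℝ)).smul_const (proj v)).const_add (proj q)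
    have hu' : HasFDerivAt u (fderiv ℝ u (proj q)) (proj q + (0 : ℝ) • proj v) := by
      simpa using hu
    have h₃ := hu'.comp_hasDerivAt (0 : ℝ) hl
    refine ⟨fun t => ((proj q + t • proj v).1, (proj q + t • proj v).2, u (proj q + t • proj v)),
      ?_, ?_, ?_⟩
    · simp only [zero_smul, add_zero, ← hz]
      rfl
    · filter_upwards [hl.continuousAt.eventually_mem (h.isOpen_base.mem_nhds
        (by simpa using h.proj_mem q hq))] with t ht
      exact h.mem_of_lift ht
    · convert hl.fst.prodMk (hl.snd.prodMk h₃) using 1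
      rw [← hv]
      rfl

/-- The contact form restricted to the tangent plane is `cross (charDir u w)`, read in the base
coordinates, so it vanishes identically only when `charDir u w = 0`. -/
lemma mem_singularSet_iff (h : IsGraphOn S W Ω u) {q : Heis} (hq : q ∈ W) (hqS : q ∈ S) :
    q ∈ singularSet S ↔ charDir u (proj q) = 0 := by
  have hdecomp : ∀ v : Heis, fderiv ℝ u (proj q) (proj v) =
      v.1 * fderiv ℝ u (proj q) (1, 0) + v.2.1 * fderiv ℝ u (proj q) (0, 1) := by
    intro v
    have : proj v = v.1 • ((1, 0) : ℝ × ℝ) + v.2.1 • ((0, 1) : ℝ × ℝ) := by simp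
    rw [this, map_add, map_smul, map_smul, smul_eq_mul, smul_eq_mul]
  have h₁ : q ∈ singularSet S ↔ tangentVectors S q = contactPlane q := and_iff_right hqS
  rw [h₁, Set.ext_iff]
  simp only [h.mem_tangentVectors_iff hq hqS, hdecomp, contactPlane, contactForm, mem_ofPred_eq]
  simp only [charDir, Prod.mk_eq_zero, proj_apply]
  constructor
  · intro H
    have h1 := H (1, 0, fderiv ℝ u (proj q) (1, 0))
    have h2 := H (0, 1, fderiv ℝ u (proj q) (0, 1))
    simp only [proj_apply] at h1 h2
    norm_num at h1 h2
    constructor <;> linarith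
  · rintro ⟨h1, h2⟩ v
    have h1' : fderiv ℝ u (q.1, q.2.1) (0, 1) = - q.1 := by linarith
    have h2' : fderiv ℝ u (q.1, q.2.1) (1, 0) = q.2.1 := by linarith
    rw [h1', h2']
    constructor <;> intro h <;> linarith

lemma contDiffAt_charDir (h : IsGraphOn S W Ω u) {w : ℝ × ℝ} (hw : w ∈ Ω) :
    ContDiffAt ℝ ∞ (charDir u) w := by
  have h₁ : ContDiffAt ℝ ∞ (fderiv ℝ u) w := (h.contDiffAt hw).fderiv_right (by simp)
  unfold charDir
  exact ((h₁.clm_apply contDiffAt_const).add contDiffAt_fst).prodMk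
    (contDiffAt_snd.sub (h₁.clm_apply contDiffAt_const))

/-- The mixed second derivatives of `u` cancel; the terms `x` and `y` contribute `1` each. This
fixes the eigenvalue in the scalar case. -/
lemma charDir_trace (h : IsGraphOn S W Ω u) {w : ℝ × ℝ} (hw : w ∈ Ω) :
    (fderiv ℝ (charDir u) w (1, 0)).1 + (fderiv ℝ (charDir u) w (0, 1)).2 = 2 := by
  have h₁ : ContDiffAt ℝ ∞ (fderiv ℝ u) w := (h.contDiffAt hw).fderiv_right (by simp)
  have hd : HasFDerivAt (fderiv ℝ u) (fderiv ℝ (fderiv ℝ u) w) w :=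
    (h₁.differentiableAt (by simp)).hasFDerivAt
  have hsymm : IsSymmSndFDerivAt ℝ u w := (h.contDiffAt hw).isSymmSndFDerivAt
    (by rw [minSmoothness_of_isRCLikeNormedField]; exact WithTop.coe_le_coe.2 (le_top : (2 : ℕ∞) ≤ ⊤))
  have hG : HasFDerivAt (charDir u) _ w :=
    ((hd.clm_apply (hasFDerivAt_const ((0, 1) : ℝ × ℝ) w)).add hasFDerivAt_fst).prodMk
      (hasFDerivAt_snd.sub (hd.clm_apply (hasFDerivAt_const ((1, 0) : ℝ × ℝ) w)))
  rw [hG.fderiv]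
  have := hsymm (1, 0) (0, 1)
  simp [this]
  ring

/-- The p-minimal surface equation: the characteristic curves are straight. -/
lemma cross_charDir_eq_zero (h : IsGraphOn S W Ω u) (hS : IsPMinimal S) {w : ℝ × ℝ} (hw : w ∈ Ω) :
    cross (charDir u w) (fderiv ℝ (charDir u) w (charDir u w)) = 0 := by
  by_cases hq : ((w.1, w.2, u w) : Heis) ∈ singularSet S
  · rw [h.mem_singularSet_iff (h.lift_mem w hw) (h.mem_of_lift hw)] at hq
    have : charDir u w = 0 := hq
    simp [this, cross]
  obtain ⟨V, E, hpV, hE, hcov⟩ := hS.curvature _ (h.mem_of_lift hw) hq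
  set lift : ℝ × ℝ → Heis := fun a => (a.1, a.2, u a) with hlift
  have hlift_d : HasFDerivAt lift _ w :=
    hasFDerivAt_fst.prodMk (hasFDerivAt_snd.prodMk (h.hasFDerivAt hw))
  have hEd : HasFDerivAt E (fderiv ℝ E (lift w)) (lift w) :=
    ((hE.smooth.contDiffAt (hE.isOpen.mem_nhds hpV)).differentiableAt (by simp)).hasFDerivAt
  have hmem : ∀ᶠ a in 𝓝 w, a ∈ Ω ∧ lift a ∈ V :=
    (h.isOpen_base.eventually_mem hw).and
      (hlift_d.continuousAt.eventually_mem (hE.isOpen.mem_nhds hpV))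
  have htan : ∀ a, a ∈ Ω → lift a ∈ V →
      (E (lift a)).2.2 = fderiv ℝ u a (proj (E (lift a))) ∧
      contactForm (lift a) (E (lift a)) = 0 := fun a ha haV =>
    ⟨(h.mem_tangentVectors_iff (h.lift_mem a ha) (h.mem_of_lift ha) _).1
      (hE.tangent _ ⟨h.mem_of_lift ha, haV⟩), hE.horizontal _ ⟨h.mem_of_lift ha, haV⟩⟩
  set e : ℝ × ℝ → ℝ × ℝ := fun a => proj (E (lift a)) with he
  -- `E` is tangent and horizontal, so its projection is parallel to `charDir u`.
  have hcross : ∀ᶠ a in 𝓝 w, cross (e a) (charDir u a) = 0 := by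
    filter_upwards [hmem] with a ⟨ha, haV⟩
    obtain ⟨h₁, h₂⟩ := htan a ha haV
    have : proj (E (lift a)) = (E (lift a)).1 • ((1, 0) : ℝ × ℝ) +
        (E (lift a)).2.1 • ((0, 1) : ℝ × ℝ) := by simp
    rw [this, map_add, map_smul, map_smul, smul_eq_mul, smul_eq_mul] at h₁
    simp only [contactForm, hlift] at h₂
    simp only [cross, charDir, he, proj_apply, hlift]
    simp only [hlift] at h₁
    linarith
  have hed : HasFDerivAt e (proj.comp ((fderiv ℝ E (lift w)).comp _)) w :=
    proj.hasFDerivAt.comp w (hEd.comp w hlift_d)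
  have hGd : HasFDerivAt (charDir u) (fderiv ℝ (charDir u) w) w :=
    ((h.contDiffAt_charDir hw).differentiableAt (by simp)).hasFDerivAt
  have hlift_e : (E (lift w)) = ((ContinuousLinearMap.fst ℝ ℝ ℝ).prod
      ((ContinuousLinearMap.snd ℝ ℝ ℝ).prod (fderiv ℝ u w))) (e w) := by
    ext
    · rfl
    · rfl
    · exact (htan w hw hpV).1
  -- For `H = 0` the frame coefficients of `∇_{e₁} e₂` vanish; up to sign and order these are the
  -- derivatives of the two plane components of `E`.
  have hzero : proj (fderiv ℝ E (lift w) (E (lift w))) = 0 := by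
    have hE1 : fderiv ℝ (fun q => (E q).1) (lift w) =
      (ContinuousLinearMap.fst ℝ ℝ (ℝ × ℝ)).comp (fderiv ℝ E (lift w)) := hEd.fst.fderiv
    have hE2 : fderiv ℝ (fun q => (E q).2.1) (lift w) =
      ((ContinuousLinearMap.fst ℝ ℝ ℝ).comp ((ContinuousLinearMap.snd ℝ ℝ (ℝ × ℝ)).comp
        (fderiv ℝ E (lift w)))) := hEd.snd.fst.fderiv
    have c1 := congrArg (fun v : Heis => v.1) hcov
    have c2 := congrArg (fun v : Heis => v.2.1) hcov
    simp only [covDeriv, crJ, frame1, frame2, reeb, contactForm] at c1 c2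
    simp at c1 c2
    change fderiv ℝ (fun q => (E q).2.1) (lift w) (E (lift w)) = 0 at c1
    change fderiv ℝ (fun q => (E q).1) (lift w) (E (lift w)) = 0 at c2
    rw [hE1] at c2
    rw [hE2] at c1
    simp at c1 c2
    simp [c1, c2]
  have hde : fderiv ℝ e w (e w) = 0 := by
    rw [hed.fderiv, ContinuousLinearMap.comp_apply, ContinuousLinearMap.comp_apply, ← hlift_e,
      hzero]
  have hunit : (e w).1 ^ 2 + (e w).2 ^ 2 = 1 := by
    have h₁ := hE.unit _ ⟨h.mem_of_lift hw, hpV⟩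
    have h₂ := (htan w hw hpV).2
    simp only [hlift] at h₂
    simp only [metric, h₂] at h₁
    simp only [he, proj_apply, hlift]
    linarith
  rw [hed.fderiv] at hde
  set D := fderiv ℝ (charDir u) w
  -- Differentiate `cross e G = 0` in the direction `e`: the derivative of `e` drops out by `hde`,
  -- leaving `cross e (D e) = 0`. Since `G = μ e` at `w`, the claim is `μ ^ 2` times this.
  have hder := (((hed.fst).mul hGd.snd).sub (hed.snd.mul hGd.fst)).congr_of_eventuallyEq
    (f₁ := fun _ => (0 : ℝ)) (by filter_upwards [hcross] with a ha using ha.symm)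
  have hz := DFunLike.congr_fun (hder.unique (hasFDerivAt_const (0 : ℝ) w)) (e w)
  have hc0 : cross (e w) (charDir u w) = 0 := hcross.self_of_nhds
  have hGe : charDir u w = ((e w).1 * (charDir u w).1 + (e w).2 * (charDir u w).2) • e w := by
    simp only [cross] at hc0
    ext
    · simp only [Prod.smul_fst, smul_eq_mul]
      linear_combination (-(charDir u w).1) * hunit - (e w).2 * hc0
    · simp only [Prod.smul_snd, smul_eq_mul]
      linear_combination (-(charDir u w).2) * hunit + (e w).1 * hc0
  generalize ((e w).1 * (charDir u w).1 + (e w).2 * (charDir u w).2) = μ at hGe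
  rw [hGe, map_smul]
  simp only [sub_apply, add_apply,
    smul_apply, ContinuousLinearMap.comp_apply (ContinuousLinearMap.fst ℝ ℝ ℝ),
    ContinuousLinearMap.comp_apply (ContinuousLinearMap.snd ℝ ℝ ℝ), hde] at hz
  simp at hz
  simp only [cross, Prod.smul_fst, Prod.smul_snd, smul_eq_mul]
  linear_combination μ ^ 2 * hz

end IsGraphOn

/-! ### Non-scalar derivative: arcs of singular points. -/

/-- `C` is an embedded `C¹` arc in a neighbourhood of its point `p`. -/
def IsArcAt (C : Set Heis) (p : Heis) : Prop :=
  ∃ (W : Set Heis) (ε : ℝ) (γ : ℝ → Heis), IsOpen W ∧ 0 < ε ∧ γ 0 = p ∧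
    ContDiffOn ℝ 1 γ (Ioo (-ε) ε) ∧ (∀ t ∈ Ioo (-ε) ε, deriv γ t ≠ 0) ∧
    IsEmbedding ((Ioo (-ε) ε).domRestrict γ) ∧ γ '' Ioo (-ε) ε = C ∩ W

/-- The cross product with a fixed vector, as a continuous linear form. -/
noncomputable def crossL (v : ℝ × ℝ) : ℝ × ℝ →L[ℝ] ℝ :=
  v.1 • ContinuousLinearMap.snd ℝ ℝ ℝ - v.2 • ContinuousLinearMap.fst ℝ ℝ ℝ

@[simp] lemma crossL_apply (v x : ℝ × ℝ) : crossL v x = cross v x := rfl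

lemma eq_smul_of_cross_eq_zero {v x : ℝ × ℝ} (hv : v ≠ 0) (h : cross v x = 0) :
    ∃ c : ℝ, x = c • v := by
  have hn : v.1 ^ 2 + v.2 ^ 2 ≠ 0 := by
    intro h0
    apply hv
    ext
    · simp only [Prod.fst_zero]; nlinarith [sq_nonneg v.1, sq_nonneg v.2]
    · simp only [Prod.snd_zero]; nlinarith [sq_nonneg v.1, sq_nonneg v.2]
  simp only [cross] at h
  refine ⟨(v.1 * x.1 + v.2 * x.2) / (v.1 ^ 2 + v.2 ^ 2), ?_⟩
  ext
  · simp only [Prod.smul_fst, smul_eq_mul]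
    field_simp
    linear_combination -v.2 * h
  · simp only [Prod.smul_snd, smul_eq_mul]
    field_simp
    linear_combination v.1 * h

/-- A plane endomorphism of trace two for which every vector is an eigenvector is the identity. -/
lemma eq_id_of_cross_eq_zero (A : ℝ × ℝ →L[ℝ] ℝ × ℝ) (htr : (A (1, 0)).1 + (A (0, 1)).2 = 2)
    (h : ∀ v, cross v (A v) = 0) : A = ContinuousLinearMap.id ℝ (ℝ × ℝ) := by
  have h1 := h (1, 0)
  have h2 := h (0, 1)
  have h3 := h ((1, 0) + (0, 1))
  rw [map_add] at h3
  simp only [cross, Prod.fst_add, Prod.snd_add] at h1 h2 h3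
  have e1 : A (1, 0) = (1, 0) := by ext <;> simp <;> linarith
  have e2 : A (0, 1) = (0, 1) := by ext <;> simp <;> linarith
  ext <;> simp [e1, e2]

section

variable {S W : Set Heis} {Ω : Set (ℝ × ℝ)} {u : ℝ × ℝ → ℝ}

/-- At a singular point where the derivative of the characteristic direction is not scalar, the
singular set is an arc. -/
lemma IsGraphOn.isArcAt (h : IsGraphOn S W Ω u) (hS : IsPMinimal S) {p : Heis} (hp : p ∈ W)
    (hps : p ∈ singularSet S) {v : ℝ × ℝ}
    (hv : cross v (fderiv ℝ (charDir u) (proj p) v) ≠ 0) : IsArcAt (singularSet S) p := by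
  have hv0 : v ≠ 0 := by
    rintro rfl
    simp [cross] at hv
  set w₀ := proj p with hw₀
  have hw₀Ω : w₀ ∈ Ω := h.proj_mem p hp
  have hG₀ : charDir u w₀ = 0 := (h.mem_singularSet_iff hp hps.1).1 hps
  have hGs : ContDiffOn ℝ ∞ (charDir u) Ω := fun w hw => (h.contDiffAt_charDir hw).contDiffWithinAt
  have hGd : ∀ w ∈ Ω, HasFDerivAt (charDir u) (fderiv ℝ (charDir u) w) w := fun w hw =>
    ((h.contDiffAt_charDir hw).differentiableAt (by simp)).hasFDerivAt
  set V : Set (ℝ × ℝ) := Ω ∩ (fun w => crossL v (fderiv ℝ (charDir u) w v)) ⁻¹' {0}ᶜ with hV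
  have hVo : IsOpen V := by
    refine ContinuousOn.isOpen_inter_preimage ?_ h.isOpen_base isOpen_compl_singleton
    exact (crossL v).continuous.comp_continuousOn
      ((hGs.continuousOn_fderiv_of_isOpen h.isOpen_base (by simp)).clm_apply continuousOn_const)
  -- The one equation `cross v G = 0` already cuts out the zeros of `G`: if `G = c v`, straightness
  -- reads `c ^ 2 * cross v (DG v) = 0`, and the second factor is nonzero on `V`.
  have hzero : ∀ w ∈ V, cross v (charDir u w) = 0 → charDir u w = 0 := by
    intro w hw h0
    obtain ⟨c, hc⟩ := eq_smul_of_cross_eq_zero hv0 h0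
    have := h.cross_charDir_eq_zero hS hw.1
    rw [hc, map_smul] at this
    have h2 : c ^ 2 * cross v (fderiv ℝ (charDir u) w v) = 0 := by
      simp only [cross, Prod.smul_fst, Prod.smul_snd, smul_eq_mul] at this ⊢
      linarith
    have hne : cross v (fderiv ℝ (charDir u) w v) ≠ 0 := hw.2
    have : c = 0 := by simpa [hne] using h2
    rw [hc, this, zero_smul]
  -- Coordinates in which the zeros of `G` form the first axis. The derivative at `w₀` is injective:
  -- the first entry kills only multiples of `v`, and the second does not kill `v`.
  set P : ℝ × ℝ → ℝ × ℝ := fun w => (crossL v (w - w₀), crossL v (charDir u w)) with hP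
  have hPs : ContDiffOn ℝ ∞ P V :=
    ((crossL v).contDiff.comp (contDiff_id.sub contDiff_const)).contDiffOn.prodMk
      ((crossL v).contDiff.comp_contDiffOn (hGs.mono inter_subset_left))
  have hPd : fderiv ℝ P w₀ = (crossL v).prod ((crossL v).comp (fderiv ℝ (charDir u) w₀)) :=
    (((crossL v).hasFDerivAt.comp w₀ ((hasFDerivAt_id w₀).sub_const w₀)).prodMk
      ((crossL v).hasFDerivAt.comp w₀ (hGd w₀ hw₀Ω))).fderiv
  have hinj : Function.Injective (fderiv ℝ P w₀) := by
    rw [hPd, injective_iff_map_eq_zero]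
    intro x hx
    simp only [ContinuousLinearMap.prod_apply, ContinuousLinearMap.comp_apply, crossL_apply,
      Prod.mk_eq_zero] at hx
    obtain ⟨c, rfl⟩ := eq_smul_of_cross_eq_zero hv0 hx.1
    have : c * cross v (fderiv ℝ (charDir u) w₀ v) = 0 := by
      have := hx.2
      rw [map_smul] at this
      simp only [cross, Prod.smul_fst, Prod.smul_snd, smul_eq_mul] at this ⊢
      linarith
    have : c = 0 := by simpa [hv] using this
    rw [this, zero_smul]
  obtain ⟨e, he, hae, heV, hsymm⟩ := exists_openPartialHomeomorph hVo hPs ⟨hw₀Ω, hv⟩ hinj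
  have heP : ∀ w, e w = (cross v (w - w₀), cross v (charDir u w)) := fun w => by rw [he]; rfl
  have he0 : e w₀ = (0, 0) := by simp [heP, hG₀, cross]
  have hline : Continuous fun s : ℝ => (s, (0 : ℝ)) := by fun_prop
  obtain ⟨ε, hε, hball⟩ := Metric.isOpen_iff.1 (e.open_target.preimage hline) 0
    (by rw [mem_preimage, ← he0]; exact e.map_source hae)
  rw [Real.ball_eq_Ioo, zero_sub, zero_add] at hball
  set γ : ℝ → Heis := fun s =>
    ((e.symm (s, 0)).1, (e.symm (s, 0)).2, u (e.symm (s, 0))) with hγ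
  have hγs : ContDiffOn ℝ ∞ γ (Ioo (-ε) ε) := by
    have h₁ : ContDiffOn ℝ ∞ (fun s : ℝ => e.symm (s, 0)) (Ioo (-ε) ε) :=
      hsymm.comp (contDiff_id.prodMk contDiff_const).contDiffOn hball
    exact h₁.fst.prodMk (h₁.snd.prodMk (h.smooth.comp h₁ fun s hs =>
      (heV (e.map_target (hball hs))).1))
  have hmem : ∀ s ∈ Ioo (-ε) ε, e.symm (s, 0) ∈ e.source := fun s hs => e.map_target (hball hs)
  have hval : ∀ s ∈ Ioo (-ε) ε, cross v (e.symm (s, 0) - w₀) = s ∧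
      cross v (charDir u (e.symm (s, 0))) = 0 := by
    intro s hs
    have := e.right_inv (hball hs)
    rw [heP] at this
    exact ⟨congrArg Prod.fst this, congrArg Prod.snd this⟩
  -- A continuous left inverse of `γ`; it yields both the nonzero velocity and the embedding.
  have hτ : ∀ s ∈ Ioo (-ε) ε, crossL v (proj (γ s) - w₀) = s := fun s hs => (hval s hs).1
  refine ⟨W ∩ proj ⁻¹' (e.source ∩ (fun w => crossL v (w - w₀)) ⁻¹' Ioo (-ε) ε), ε, γ, ?_, hε, ?_,
    hγs.of_le (by simp), ?_, ?_, ?_⟩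
  · refine h.isOpen.inter ((e.open_source.inter ?_).preimage proj.continuous)
    exact isOpen_Ioo.preimage ((crossL v).continuous.comp (continuous_id.sub continuous_const))
  · have : e.symm (0, 0) = w₀ := by rw [← he0, e.left_inv hae]
    simp only [hγ, this]
    rw [hw₀, ← (h.mem_iff p hp).1 hps.1]
    rfl
  · intro t ht h0
    have hd : HasDerivAt γ 0 t := by
      rw [← h0]
      exact ((hγs.contDiffAt (isOpen_Ioo.mem_nhds ht)).differentiableAt (by simp)).hasDerivAt
    have h₁ : HasDerivAt (fun s => crossL v (proj (γ s) - w₀)) (crossL v (proj 0)) t :=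
      (crossL v).hasFDerivAt.comp_hasDerivAt t
        ((proj.hasFDerivAt.comp_hasDerivAt t hd).sub_const w₀)
    have h₂ : HasDerivAt (fun s => crossL v (proj (γ s) - w₀)) 1 t :=
      (hasDerivAt_id t).congr_of_eventuallyEq
        (by filter_upwards [isOpen_Ioo.mem_nhds ht] with s hs using hτ s hs)
    have := h₁.unique h₂
    simp [cross] at this
  · have hc : Continuous fun q : Heis => crossL v (proj q - w₀) :=
      (crossL v).continuous.comp (proj.continuous.sub continuous_const)
    refine IsEmbedding.of_comp (continuousOn_iff_continuous_domRestrict.1 hγs.continuousOn) hc ?_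
    convert IsEmbedding.subtypeVal (p := fun s => s ∈ Ioo (-ε) ε) using 1
    ext s
    exact hτ s.1 s.2
  · ext q
    constructor
    · rintro ⟨s, hs, rfl⟩
      have hsV := heV (hmem s hs)
      refine ⟨?_, h.lift_mem _ hsV.1, hmem s hs, ?_⟩
      · rw [h.mem_singularSet_iff (h.lift_mem _ hsV.1) (h.mem_of_lift hsV.1)]
        exact hzero _ hsV (hval s hs).2
      · rw [mem_preimage, hτ s hs]
        exact hs
    · rintro ⟨hqs, hqW, hqe, hqε⟩
      have hG := (h.mem_singularSet_iff hqW hqs.1).1 hqs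
      have : e (proj q) = (crossL v (proj q - w₀), 0) := by
        rw [heP, hG]
        simp [cross]
      refine ⟨_, hqε, ?_⟩
      have h₂ : e.symm (crossL v (proj q - w₀), 0) = proj q := by rw [← this, e.left_inv hqe]
      simp only [hγ]
      rw [h₂, ← (h.mem_iff q hqW).1 hqs.1]
      rfl

end

/-! ### Derivative the identity: radial characteristic lines and the plane. -/

lemma eventually_lt_of_hasDerivAt_pos {ψ : ℝ → ℝ} {d : ℝ} (h : HasDerivAt ψ d 0) (hd : 0 < d) :
    ∀ᶠ t in 𝓝[>] (0 : ℝ), ψ 0 < ψ t := by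
  have h₁ := (h.tendsto_slope.mono_left (nhdsGT_le_nhdsNE 0)).eventually (lt_mem_nhds hd)
  filter_upwards [h₁, self_mem_nhdsWithin] with t ht ht0
  have ht0' : 0 < t := ht0
  rw [slope_def_field, sub_zero] at ht
  have := (div_pos_iff_of_pos_right ht0').1 ht
  linarith

/-- A plane field with derivative the identity at a zero and straight integral curves is radial. -/
lemma eventually_cross_sub_eq_zero {G : ℝ × ℝ → ℝ × ℝ} {w₀ : ℝ × ℝ} (hG : ContDiffAt ℝ 1 G w₀)
    (hG₀ : G w₀ = 0) (hA : fderiv ℝ G w₀ = ContinuousLinearMap.id ℝ (ℝ × ℝ))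
    (hcross : ∀ᶠ w in 𝓝 w₀, cross (G w) (fderiv ℝ G w (G w)) = 0) :
    ∀ᶠ w in 𝓝 w₀, cross (G w) (w - w₀) = 0 := by
  -- Maximum principle for `f ^ 4 / N ^ 3`. Moving along `-G`, `f` decays at rate about `1` and `N`
  -- at rate about `2`, so the quotient grows at rate about `2`. A positive maximum is therefore
  -- impossible, and `f = 0`.
  set N : ℝ × ℝ → ℝ := fun w => (w - w₀).1 ^ 2 + (w - w₀).2 ^ 2 with hN
  set f : ℝ × ℝ → ℝ := fun w => cross (G w) (w - w₀) with hf
  have hd₀ : HasFDerivAt G (ContinuousLinearMap.id ℝ (ℝ × ℝ)) w₀ := by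
    rw [← hA]
    exact (hG.differentiableAt (by simp)).hasFDerivAt
  -- The two bounds `1 / 16` give the rates `7 / 8` in `hdot` and `17 / 16` in `hl1`; what is needed
  -- is `4 * (17 / 16) < 6 * (7 / 8)`.
  have hδ : ∀ᶠ w in 𝓝 w₀, ‖G w - (w - w₀)‖ ≤ 1 / 16 * ‖w - w₀‖ := by
    have := hd₀.isLittleO.bound (c := 1 / 16) (by norm_num)
    filter_upwards [this] with w hw
    simpa [hG₀] using hw
  have hη : ∀ᶠ w in 𝓝 w₀, ‖fderiv ℝ G w - ContinuousLinearMap.id ℝ (ℝ × ℝ)‖ < 1 / 16 := by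
    have : ContinuousAt (fderiv ℝ G) w₀ := hG.continuousAt_fderiv (by simp)
    have := Metric.tendsto_nhds.1 this (1 / 16) (by norm_num)
    filter_upwards [this] with w hw
    rwa [dist_eq_norm, hA] at hw
  have hdiff : ∀ᶠ w in 𝓝 w₀, DifferentiableAt ℝ G w := by
    filter_upwards [hG.eventually (by simp)] with w hw using hw.differentiableAt (by simp)
  obtain ⟨r, hr, hball⟩ := Metric.nhds_basis_closedBall.eventually_iff.1
    (hδ.and (hη.and (hdiff.and hcross)))
  -- A Euclidean disc, not a ball of the sup norm on `ℝ × ℝ`: a step that decreases `N` stays in it.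
  set K : Set (ℝ × ℝ) := {w | N w ≤ r ^ 2} with hK
  have hNc : Continuous N := by fun_prop
  have hle : ∀ w, ‖w - w₀‖ ^ 2 ≤ N w := by
    intro w
    rw [Prod.norm_def]
    simp only [hN]
    rcases max_choice ‖(w - w₀).1‖ ‖(w - w₀).2‖ with h | h <;> rw [h, Real.norm_eq_abs, sq_abs]
    · linarith [sq_nonneg (w - w₀).2]
    · linarith [sq_nonneg (w - w₀).1]
  have hKr : K ⊆ Metric.closedBall w₀ r := by
    intro w hw
    rw [Metric.mem_closedBall, dist_eq_norm]
    exact abs_le_of_sq_le_sq' ((hle w).trans hw) hr.le |>.2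
  have hKc : IsCompact K :=
    (isCompact_closedBall w₀ r).of_isClosed_subset (isClosed_le hNc continuous_const) hKr
  have hN0 : ∀ w, 0 ≤ N w := fun w => by positivity
  have hNpos : ∀ w, w ≠ w₀ → 0 < N w := by
    intro w hw
    have := norm_pos_iff.2 (sub_ne_zero.2 hw)
    exact lt_of_lt_of_le (by positivity) (hle w)
  have hcomp : ∀ w ∈ K, |(G w).1 - (w - w₀).1| ≤ 1 / 16 * ‖w - w₀‖ ∧
      |(G w).2 - (w - w₀).2| ≤ 1 / 16 * ‖w - w₀‖ := by
    intro w hw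
    have := (hball (hKr hw)).1
    exact ⟨(norm_fst_le (G w - (w - w₀))).trans this, (norm_snd_le (G w - (w - w₀))).trans this⟩
  have hfst : ∀ w, |(w - w₀).1| ≤ ‖w - w₀‖ := fun w => norm_fst_le (w - w₀)
  have hsnd : ∀ w, |(w - w₀).2| ≤ ‖w - w₀‖ := fun w => norm_snd_le (w - w₀)
  have hfN : ∀ w ∈ K, |f w| ≤ N w := by
    intro w hw
    obtain ⟨h1, h2⟩ := hcomp w hw
    have e : f w = ((G w).1 - (w - w₀).1) * (w - w₀).2 - ((G w).2 - (w - w₀).2) * (w - w₀).1 := by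
      simp only [hf, cross]
      ring
    rw [e]
    refine (abs_sub _ _).trans ?_
    rw [abs_mul, abs_mul]
    have m1 := mul_le_mul h1 (hsnd w) (abs_nonneg _) (by positivity)
    have m2 := mul_le_mul h2 (hfst w) (abs_nonneg _) (by positivity)
    nlinarith [hle w]
  have hdot : ∀ w ∈ K, 7 / 8 * N w ≤ (w - w₀).1 * (G w).1 + (w - w₀).2 * (G w).2 := by
    intro w hw
    obtain ⟨h1, h2⟩ := hcomp w hw
    have m1 := mul_le_mul h1 (hfst w) (abs_nonneg _) (by positivity)
    have m2 := mul_le_mul h2 (hsnd w) (abs_nonneg _) (by positivity)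
    rw [← abs_mul] at m1 m2
    have a1 := (abs_le.1 m1).1
    have a2 := (abs_le.1 m2).1
    have := hle w
    simp only [hN] at this ⊢
    nlinarith
  have hfc : ∀ w ∈ K, ContinuousAt f w := by
    intro w hw
    have hc := (hball (hKr hw)).2.2.1.continuousAt
    simp only [hf, cross]
    fun_prop
  -- The exponents satisfy `3 < 4`, so that `|f| ≤ N` gives continuity at `w₀`, and `4 < 2 * 3`, so
  -- that the quotient grows inward. At `w₀` division by zero gives the value `0`, which is the
  -- limit.
  set H : ℝ × ℝ → ℝ := fun w => f w ^ 4 / N w ^ 3 with hH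
  have hHc : ContinuousOn H K := by
    intro w hw
    by_cases hww : w = w₀
    · subst hww
      have hN₀ : N w = 0 := by simp [hN]
      have hH₀ : H w = 0 := by simp [hH, hN₀]
      rw [ContinuousWithinAt, hH₀]
      refine squeeze_zero' (.of_forall fun x => by positivity) (g := N) ?_
        (by simpa [hN₀] using hNc.continuousWithinAt (s := K) (x := w).tendsto)
      filter_upwards [self_mem_nhdsWithin] with x hx
      refine div_le_of_le_mul₀ (by positivity) (hN0 x) ?_
      calc f x ^ 4 = |f x| ^ 4 := (Even.pow_abs (by decide) _).symm
        _ ≤ N x ^ 4 := pow_le_pow_left₀ (abs_nonneg _) (hfN x hx) 4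
        _ = N x * N x ^ 3 := by ring
    · exact ((hfc w hw).pow 4 |>.div (hNc.continuousAt.pow 3)
        (pow_ne_zero 3 (hNpos w hww).ne')).continuousWithinAt
  obtain ⟨w, hwK, hmax⟩ := hKc.exists_isMaxOn ⟨w₀, by simp [hK, hN, sq_nonneg]⟩ hHc
  have hbound : ∀ x ∈ K, f x ^ 4 ≤ H w * N x ^ 3 := by
    intro x hx
    by_cases hxw : x = w₀
    · simp [hxw, hf, hN, cross]
    · exact (div_le_iff₀ (pow_pos (hNpos x hxw) 3)).1 (hmax hx)
  have hM : H w = 0 := by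
    by_contra hne
    have hMpos : 0 < H w := lt_of_le_of_ne (by positivity) (Ne.symm hne)
    have hww : w ≠ w₀ := by
      rintro rfl
      exact hne (by simp [hH, hN])
    have hNw := hNpos w hww
    obtain ⟨-, hη', hd', hc'⟩ := hball (hKr hwK)
    have hdw := hdot w hwK
    have hGne : G w ≠ 0 := by
      intro h0
      rw [h0] at hdw
      simp at hdw
      linarith
    obtain ⟨l, hl⟩ := eq_smul_of_cross_eq_zero hGne hc'
    have hl1 : l < 17 / 16 := by
      have h1 := (fderiv ℝ G w - ContinuousLinearMap.id ℝ (ℝ × ℝ)).le_opNorm (G w)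
      have h2 : (fderiv ℝ G w - ContinuousLinearMap.id ℝ (ℝ × ℝ)) (G w) = (l - 1) • G w := by
        rw [sub_apply, hl, sub_smul, one_smul]
        rfl
      rw [h2, norm_smul, Real.norm_eq_abs] at h1
      have h3 := le_of_mul_le_mul_right h1 (norm_pos_iff.2 hGne)
      linarith [le_abs_self (l - 1)]
    have hline : HasDerivAt (fun t : ℝ => w - t • G w) (-G w) 0 := by
      simpa using ((hasDerivAt_id (0 : ℝ)).smul_const (G w)).const_sub w
    have hline' : HasDerivAt (fun t : ℝ => w - t • G w - w₀) (-G w) 0 := hline.sub_const w₀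
    have hl1' : HasDerivAt (fun t : ℝ => (w - t • G w - w₀).1) (-G w).1 0 := hline'.fst
    have hl2' : HasDerivAt (fun t : ℝ => (w - t • G w - w₀).2) (-G w).2 0 := hline'.snd
    have hGl : HasDerivAt (fun t : ℝ => G (w - t • G w)) (-(l • G w)) 0 := by
      have : HasFDerivAt G (fderiv ℝ G w) (w - (0 : ℝ) • G w) := by simpa using hd'.hasFDerivAt
      have := this.comp_hasDerivAt (0 : ℝ) hline
      rwa [map_neg, hl] at this
    have hG1 : HasDerivAt (fun t : ℝ => (G (w - t • G w)).1) (-(l • G w)).1 0 := hGl.fst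
    have hG2 : HasDerivAt (fun t : ℝ => (G (w - t • G w)).2) (-(l • G w)).2 0 := hGl.snd
    have hNl : HasDerivAt (fun t : ℝ => N (w - t • G w))
        (-2 * ((w - w₀).1 * (G w).1 + (w - w₀).2 * (G w).2)) 0 := by
      refine ((hl1'.pow 2).add (hl2'.pow 2)).congr_deriv ?_
      simp
      ring
    -- Moving the base point contributes only `cross G G = 0`; the rest comes from `DG(G) = l G`.
    have hfl : HasDerivAt (fun t : ℝ => f (w - t • G w)) (-(l * f w)) 0 := by
      refine ((hG1.mul hl2').sub (hG2.mul hl1')).congr_deriv ?_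
      simp [hf, cross]
      ring
    -- `f ^ 4 - H w * N ^ 3` is `0` at `t = 0` with positive derivative, hence positive just after,
    -- against `hbound`. This form avoids differentiating a quotient.
    have hψ := (hfl.pow 4).sub ((hNl.pow 3).const_mul (H w))
    have hfM : f w ^ 4 = H w * N w ^ 3 := by
      simp only [hH]
      field_simp
    have e1 := eventually_lt_of_hasDerivAt_pos hψ (by
      simp only [zero_smul, sub_zero]
      norm_num
      have : H w * (3 * N w ^ 2 * (2 * ((w - w₀).1 * (G w).1 + (w - w₀).2 * (G w).2))) -
        4 * l * f w ^ 4 > 0 := by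
        rw [hfM]
        have : H w * N w ^ 2 * (6 * ((w - w₀).1 * (G w).1 + (w - w₀).2 * (G w).2) -
          4 * l * N w) > 0 := by
          refine mul_pos (by positivity) ?_
          nlinarith
        linarith
      simp only [Prod.fst_sub, Prod.snd_sub] at this
      linarith)
    have e2 := eventually_lt_of_hasDerivAt_pos hNl.neg (by linarith)
    obtain ⟨t, ht1, ht2⟩ := (e1.and e2).exists
    simp only [zero_smul, sub_zero, Pi.sub_apply, Pi.pow_apply, Pi.neg_apply] at ht1 ht2
    have hxK : w - t • G w ∈ K := by
      have : N w ≤ r ^ 2 := hwK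
      simp only [hK, mem_ofPred_eq]
      linarith
    have := hbound _ hxK
    linarith
  have hKn : ∀ᶠ x in 𝓝 w₀, N x < r ^ 2 :=
    hNc.continuousAt.eventually_lt continuousAt_const (by simp [hN, hr])
  filter_upwards [hKn] with x hx
  have := hbound x hx.le
  rw [hM, zero_mul] at this
  have h4 : f x ^ 4 = 0 := le_antisymm this (by positivity)
  exact pow_eq_zero_iff (by norm_num) |>.1 h4

section

variable {S W : Set Heis} {Ω : Set (ℝ × ℝ)} {u : ℝ × ℝ → ℝ}

/-- If the characteristic direction is radial around `w₀`, the graph is a plane near `w₀`. -/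
lemma IsGraphOn.eventually_eq_affine (h : IsGraphOn S W Ω u) {w₀ : ℝ × ℝ} (hw₀ : w₀ ∈ Ω)
    (hG₀ : charDir u w₀ = 0) (hrad : ∀ᶠ w in 𝓝 w₀, cross (charDir u w) (w - w₀) = 0) :
    ∀ᶠ w in 𝓝 w₀, u w = u w₀ + w₀.2 * w.1 - w₀.1 * w.2 := by
  obtain ⟨r, hr, hball⟩ := Metric.nhds_basis_ball.eventually_iff.1
    (hrad.and (h.isOpen_base.eventually_mem hw₀))
  filter_upwards [Metric.ball_mem_nhds w₀ hr] with w hw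
  set d := w - w₀ with hd
  set c := w₀.2 * d.1 - w₀.1 * d.2 with hc
  have hseg : ∀ t ∈ Icc (0 : ℝ) 1, w₀ + t • d ∈ Metric.ball w₀ r := by
    intro t ht
    rw [mem_ball_iff_norm] at hw ⊢
    rw [add_sub_cancel_left, norm_smul, Real.norm_eq_abs, abs_of_nonneg ht.1]
    exact lt_of_le_of_lt (mul_le_of_le_one_left (norm_nonneg _) ht.2) hw
  -- At `w₀ + t d` radiality reads `t * (Du(d) - c) = 0`, since the terms quadratic in `d` cancel.
  -- The factor `t` is lost at `t = 0`, where `charDir u w₀ = 0` is used instead.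
  have hderiv : ∀ t ∈ Icc (0 : ℝ) 1,
      HasDerivAt (fun t : ℝ => u (w₀ + t • d) - t * c) 0 t := by
    intro t ht
    obtain ⟨h1, h2⟩ := hball (hseg t ht)
    have hl : HasDerivAt (fun t : ℝ => w₀ + t • d) d t := by
      simpa using ((hasDerivAt_id t).smul_const d).const_add w₀
    have h3 := ((h.hasFDerivAt h2).comp_hasDerivAt t hl).sub ((hasDerivAt_id t).mul_const c)
    refine h3.congr_deriv ?_
    have hdd : fderiv ℝ u (w₀ + t • d) d = d.1 * fderiv ℝ u (w₀ + t • d) (1, 0) +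
        d.2 * fderiv ℝ u (w₀ + t • d) (0, 1) := by
      have : d = d.1 • ((1, 0) : ℝ × ℝ) + d.2 • ((0, 1) : ℝ × ℝ) := by simp
      conv_lhs => rw [this]
      rw [map_add, map_smul, map_smul, smul_eq_mul, smul_eq_mul]
      simp
    rw [hdd]
    rcases ht.1.eq_or_lt with rfl | ht0
    · simp only [charDir, Prod.mk_eq_zero] at hG₀
      simp only [zero_smul, add_zero, one_mul]
      linear_combination d.2 * hG₀.1 - d.1 * hG₀.2 - hc
    · have h4 : t * ((fderiv ℝ u (w₀ + t • d) (1, 0)) * d.1 +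
          (fderiv ℝ u (w₀ + t • d) (0, 1)) * d.2 - c) = 0 := by
        simp only [cross, charDir, add_sub_cancel_left, Prod.smul_fst, Prod.smul_snd, smul_eq_mul,
          Prod.fst_add, Prod.snd_add] at h1
        rw [hc]
        linear_combination h1
      have := (mul_eq_zero.1 h4).resolve_left ht0.ne'
      linarith
  have := constant_of_has_deriv_right_zero
    (fun t ht => (hderiv t ht).continuousAt.continuousWithinAt)
    (fun t ht => (hderiv t (Ico_subset_Icc_self ht)).hasDerivWithinAt) 1 (by simp)
  simp [hd, hc] at this
  linarith

/-- The structure of a p-minimal surface near a singular point. -/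
lemma IsPMinimal.isArcAt_or_plane (hS : IsPMinimal S) {p : Heis} (hp : p ∈ singularSet S) :
    IsArcAt (singularSet S) p ∨ ∃ V : Set Heis, IsOpen V ∧ p ∈ V ∧
      ∀ q ∈ V, q ∈ S ↔ q.2.2 = p.2.2 + p.2.1 * q.1 - p.1 * q.2.1 := by
  obtain ⟨W, Ω, u, hpW, h⟩ := exists_isGraphOn hS.surface hp
  by_cases hv : ∃ v, cross v (fderiv ℝ (charDir u) (proj p) v) ≠ 0
  · obtain ⟨v, hv⟩ := hv
    exact Or.inl (h.isArcAt hS hpW hp hv)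
  · right
    push Not at hv
    have hΩ := h.proj_mem p hpW
    have hG₀ := (h.mem_singularSet_iff hpW hp.1).1 hp
    have hA := eq_id_of_cross_eq_zero _ (h.charDir_trace hΩ) hv
    have hrad := eventually_cross_sub_eq_zero ((h.contDiffAt_charDir hΩ).of_le (by simp)) hG₀ hA (by
      filter_upwards [h.isOpen_base.eventually_mem hΩ] with w hw
        using h.cross_charDir_eq_zero hS hw)
    obtain ⟨V, hV, hVo, hVp⟩ := mem_nhds_iff.1 (h.eventually_eq_affine hΩ hG₀ hrad)
    refine ⟨W ∩ proj ⁻¹' V, h.isOpen.inter (hVo.preimage proj.continuous), ⟨hpW, hVp⟩, ?_⟩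
    intro q hq
    have hqV : u (proj q) = _ := hV hq.2
    rw [h.mem_iff q hq.1, hqV, ← (h.mem_iff p hpW).1 hp.1]
    rfl

end

/-! ### Left translations and plane pieces. -/

/-- The left translation of the Heisenberg group that moves `p` to the origin. -/
def leftTranslate (p : Heis) : Heis ≃ Heis where
  toFun q := (q.1 - p.1, q.2.1 - p.2.1, q.2.2 - (p.2.2 + p.2.1 * q.1 - p.1 * q.2.1))
  invFun q := (q.1 + p.1, q.2.1 + p.2.1,
    q.2.2 + (p.2.2 + p.2.1 * (q.1 + p.1) - p.1 * (q.2.1 + p.2.1)))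
  left_inv q := by ext <;> simp
  right_inv q := by ext <;> simp

lemma leftTranslate_apply (p q : Heis) : leftTranslate p q =
    (q.1 - p.1, q.2.1 - p.2.1, q.2.2 - (p.2.2 + p.2.1 * q.1 - p.1 * q.2.1)) := rfl

lemma isRigidMotion_leftTranslate (p : Heis) : IsRigidMotion (leftTranslate p) := by
  have hs : ContDiff ℝ ∞ (leftTranslate p) := by
    change ContDiff ℝ ∞ fun q : Heis =>
      ((q.1 - p.1, q.2.1 - p.2.1, q.2.2 - (p.2.2 + p.2.1 * q.1 - p.1 * q.2.1)) : Heis)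
    fun_prop
  have hs' : ContDiff ℝ ∞ (leftTranslate p).symm := by
    change ContDiff ℝ ∞ fun q : Heis => ((q.1 + p.1, q.2.1 + p.2.1,
      q.2.2 + (p.2.2 + p.2.1 * (q.1 + p.1) - p.1 * (q.2.1 + p.2.1))) : Heis)
    fun_prop
  have hd : ∀ q v : Heis, fderiv ℝ (leftTranslate p) q v =
      (v.1, v.2.1, v.2.2 - (p.2.1 * v.1 - p.1 * v.2.1)) := by
    intro q v
    have h1 : HasFDerivAt (fun q : Heis => q.1) (ContinuousLinearMap.fst ℝ ℝ (ℝ × ℝ)) q :=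
      hasFDerivAt_fst
    have h2 : HasFDerivAt (fun q : Heis => q.2.1) ((ContinuousLinearMap.fst ℝ ℝ ℝ).comp
        (ContinuousLinearMap.snd ℝ ℝ (ℝ × ℝ))) q := hasFDerivAt_snd.fst
    have h3 : HasFDerivAt (fun q : Heis => q.2.2) ((ContinuousLinearMap.snd ℝ ℝ ℝ).comp
        (ContinuousLinearMap.snd ℝ ℝ (ℝ × ℝ))) q := hasFDerivAt_snd.snd
    have h : HasFDerivAt (leftTranslate p) _ q :=
      (h1.sub_const p.1).prodMk ((h2.sub_const p.2.1).prodMk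
        (h3.sub (((h1.const_mul p.2.1).const_add p.2.2).sub (h2.const_mul p.1))))
    rw [h.fderiv]
    rfl
  refine ⟨hs, hs', fun q v => ?_, fun q v _ => ?_⟩
  · rw [hd, leftTranslate_apply]
    simp only [contactForm]
    ring
  · rw [hd, hd, leftTranslate_apply]
    simp only [crJ, frame1, frame2]
    ext <;> simp
    ring

/-- The equation of the contact plane through `p` is the vanishing of the third coordinate of
`leftTranslate p`. -/
lemma isPlanePieceAt_of_eq_affine {S V : Set Heis} {p : Heis} (hV : IsOpen V) (hp : p ∈ V)
    (h : ∀ q ∈ V, q ∈ S ↔ q.2.2 = p.2.2 + p.2.1 * q.1 - p.1 * q.2.1) : IsPlanePieceAt S p := by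
  refine ⟨leftTranslate p, V, isRigidMotion_leftTranslate p, hV, hp, ?_, fun q hq => ?_⟩
  · rw [leftTranslate_apply]
    ext <;> simp
    ring
  · rw [h q hq, leftTranslate_apply, sub_eq_zero]

lemma mem_tangentVectors_iff_of_diffeo {S W : Set Heis} {Φ : Heis ≃ Heis} (hΦ : ContDiff ℝ ∞ Φ)
    (hΦ' : ContDiff ℝ ∞ Φ.symm) (hW : IsOpen W) (h : ∀ q ∈ W, q ∈ S ↔ (Φ q).2.2 = 0) {q : Heis}
    (hq : q ∈ W) (hqS : q ∈ S) (v : Heis) :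
    v ∈ tangentVectors S q ↔ (fderiv ℝ Φ q v).2.2 = 0 := by
  have hd : HasFDerivAt Φ (fderiv ℝ Φ q) q := (hΦ.differentiable (by simp) q).hasFDerivAt
  have hd' : HasFDerivAt Φ.symm (fderiv ℝ Φ.symm (Φ q)) (Φ q) :=
    (hΦ'.differentiable (by simp) _).hasFDerivAt
  have hz := (h q hq).1 hqS
  constructor
  · rintro ⟨γ, hγ0, hγS, hγ⟩
    rw [← hγ0] at hd hq
    have h₁ : HasDerivAt (fun t => (Φ (γ t)).2.2) (fderiv ℝ Φ (γ 0) v).2.2 0 :=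
      (hd.comp_hasDerivAt 0 hγ).snd.snd
    have h₂ : (fun t => (Φ (γ t)).2.2) =ᶠ[𝓝 0] fun _ => 0 := by
      filter_upwards [hγS, hγ.continuousAt.eventually_mem (hW.mem_nhds hq)] with t h₁ h₂
      exact (h _ h₂).1 h₁
    rw [← hγ0]
    exact h₁.unique ((hasDerivAt_const (0 : ℝ) (0 : ℝ)).congr_of_eventuallyEq h₂)
  · intro hv
    have hinv : fderiv ℝ Φ.symm (Φ q) (fderiv ℝ Φ q v) = v := by
      have h₁ : HasFDerivAt (Φ.symm ∘ Φ) _ q := hd'.comp q hd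
      rw [Φ.symm_comp_self] at h₁
      exact DFunLike.congr_fun (h₁.unique (hasFDerivAt_id q)) v
    have hl : HasDerivAt (fun t : ℝ => Φ q + t • fderiv ℝ Φ q v) (fderiv ℝ Φ q v) 0 := by
      simpa using ((hasDerivAt_id (0 : ℝ)).smul_const (fderiv ℝ Φ q v)).const_add (Φ q)
    have hd'' : HasFDerivAt Φ.symm (fderiv ℝ Φ.symm (Φ q)) (Φ q + (0 : ℝ) • fderiv ℝ Φ q v) := by
      simpa using hd'
    have hγ := hd''.comp_hasDerivAt (0 : ℝ) hl
    rw [hinv] at hγ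
    refine ⟨fun t => Φ.symm (Φ q + t • fderiv ℝ Φ q v), by simp, ?_, hγ⟩
    filter_upwards [hγ.continuousAt.eventually_mem (hW.mem_nhds (by simpa using hq))] with t ht
    refine (h _ ht).2 ?_
    simp [hz, hv]

/-- `Φ` preserves the contact form, so the question moves to `{z = 0}`. There the form restricts to
`x dy - y dx`, which vanishes only at the origin; pulling back the two coordinate vectors detects
this. -/
lemma IsPlanePieceAt.isIsolatedSingularPoint {S : Set Heis} {p : Heis} (h : IsPlanePieceAt S p) :
    IsIsolatedSingularPoint S p := by
  obtain ⟨Φ, W, hΦ, hW, hpW, hp0, hS⟩ := h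
  have key : ∀ q ∈ W, q ∈ S → (q ∈ singularSet S ↔ Φ q = 0) := by
    intro q hq hqS
    have hd : HasFDerivAt Φ (fderiv ℝ Φ q) q := (hΦ.smooth.differentiable (by simp) q).hasFDerivAt
    have hd' : HasFDerivAt Φ.symm (fderiv ℝ Φ.symm (Φ q)) (Φ q) :=
      (hΦ.smooth_symm.differentiable (by simp) _).hasFDerivAt
    have hsurj : ∀ w, fderiv ℝ Φ q (fderiv ℝ Φ.symm (Φ q) w) = w := by
      intro w
      have hd₂ : HasFDerivAt Φ (fderiv ℝ Φ q) (Φ.symm (Φ q)) := by simpa using hd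
      have h₁ : HasFDerivAt (Φ ∘ Φ.symm) _ (Φ q) := hd₂.comp (Φ q) hd'
      rw [Φ.self_comp_symm] at h₁
      exact DFunLike.congr_fun (h₁.unique (hasFDerivAt_id (Φ q))) w
    have hz := (hS q hq).1 hqS
    have h₁ : q ∈ singularSet S ↔ tangentVectors S q = contactPlane q := and_iff_right hqS
    rw [h₁, Set.ext_iff]
    simp only [mem_tangentVectors_iff_of_diffeo hΦ.smooth hΦ.smooth_symm hW hS hq hqS,
      contactPlane, mem_ofPred_eq, ← hΦ.preserves_contactForm q]
    constructor
    · intro H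
      have h1 := H (fderiv ℝ Φ.symm (Φ q) (1, 0, 0))
      have h2 := H (fderiv ℝ Φ.symm (Φ q) (0, 1, 0))
      rw [hsurj] at h1 h2
      simp [contactForm] at h1 h2
      ext <;> assumption
    · intro H v
      simp [contactForm, H]
  have hpS : p ∈ S := (hS p hpW).2 (by simp [hp0])
  refine ⟨W, hW, ?_⟩
  ext q
  constructor
  · rintro ⟨hq, hqW⟩
    exact Φ.injective (((key q hqW hq.1).1 hq).trans hp0.symm)
  · rintro rfl
    exact ⟨(key q hpW hpS).2 hp0, hpW⟩

/-! ### Polar coordinates and special type I. -/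

/-- Polar coordinates around `p` on the contact plane through `p`. -/
noncomputable def polarPlane (p : Heis) (a : ℝ × ℝ) : Heis :=
  (p.1 + a.1 * Real.cos a.2, p.2.1 + a.1 * Real.sin a.2,
    p.2.2 + p.2.1 * (p.1 + a.1 * Real.cos a.2) - p.1 * (p.2.1 + a.1 * Real.sin a.2))

lemma contDiff_polarPlane (p : Heis) : ContDiff ℝ ∞ (polarPlane p) := by
  unfold polarPlane
  fun_prop

lemma fderiv_polarPlane (p : Heis) (a w : ℝ × ℝ) : fderiv ℝ (polarPlane p) a w =
    (w.1 * Real.cos a.2 - w.2 * (a.1 * Real.sin a.2),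
      w.1 * Real.sin a.2 + w.2 * (a.1 * Real.cos a.2),
      p.2.1 * (w.1 * Real.cos a.2 - w.2 * (a.1 * Real.sin a.2)) -
        p.1 * (w.1 * Real.sin a.2 + w.2 * (a.1 * Real.cos a.2))) := by
  have h1 : HasFDerivAt (fun a : ℝ × ℝ => p.1 + a.1 * Real.cos a.2) _ a :=
    ((hasFDerivAt_fst (𝕜 := ℝ)).mul (hasFDerivAt_snd (𝕜 := ℝ)).cos).const_add p.1
  have h2 : HasFDerivAt (fun a : ℝ × ℝ => p.2.1 + a.1 * Real.sin a.2) _ a :=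
    ((hasFDerivAt_fst (𝕜 := ℝ)).mul (hasFDerivAt_snd (𝕜 := ℝ)).sin).const_add p.2.1
  have h : HasFDerivAt (polarPlane p) _ a :=
    h1.prodMk (h2.prodMk (((h1.const_mul p.2.1).const_add p.2.2).sub (h2.const_mul p.1)))
  rw [h.fderiv]
  ext <;> simp <;> ring

lemma eq_zero_of_proj_fderiv_polarPlane {p : Heis} {a w : ℝ × ℝ} (ha : 0 < a.1)
    (h : proj (fderiv ℝ (polarPlane p) a w) = 0) : w = 0 := by
  rw [fderiv_polarPlane, proj_apply, Prod.mk_eq_zero] at h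
  obtain ⟨h1, h2⟩ := h
  simp only at h1 h2
  have hcs := Real.sin_sq_add_cos_sq a.2
  have e1 : w.1 = 0 := by
    linear_combination Real.cos a.2 * h1 + Real.sin a.2 * h2 - w.1 * hcs
  have e2 : w.2 * a.1 = 0 := by
    linear_combination -Real.sin a.2 * h1 + Real.cos a.2 * h2 - w.2 * a.1 * hcs
  exact Prod.ext e1 ((mul_eq_zero.1 e2).resolve_right ha.ne')

/-- Away from `p`, the contact plane through `p` is of special type I with invariant `0`. -/
lemma isSpecialTypeIAt_of_eq_affine {S V : Set Heis} {p : Heis} (hV : IsOpen V)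
    (h : ∀ q ∈ V, q ∈ S ↔ q.2.2 = p.2.2 + p.2.1 * q.1 - p.1 * q.2.1) {q : Heis} (hq : q ∈ V)
    (hqS : q ∈ S) (hqp : q ≠ p) : IsSpecialTypeIAt S q (fun _ => 0) := by
  have hqz := (h q hq).1 hqS
  set X := polarPlane p with hX
  -- The modulus and argument of `z` are the polar coordinates of `q`.
  set z : ℂ := ⟨q.1 - p.1, q.2.1 - p.2.1⟩ with hz
  set a₀ : ℝ × ℝ := (‖z‖, z.arg) with ha₀
  have hXa₀ : X a₀ = q := by
    have h1 := Complex.norm_mul_cos_arg z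
    have h2 := Complex.norm_mul_sin_arg z
    simp only [hX, polarPlane, ha₀, h1, h2]
    ext
    · simp [hz]
    · simp [hz]
    · simp [hz, hqz]
  have ha₀pos : 0 < a₀.1 := by
    refine norm_pos_iff.2 fun h0 => hqp ?_
    have h1 : q.1 = p.1 := by simpa [hz, sub_eq_zero] using congrArg Complex.re h0
    have h2 : q.2.1 = p.2.1 := by simpa [hz, sub_eq_zero] using congrArg Complex.im h0
    refine Prod.ext h1 (Prod.ext h2 ?_)
    rw [hqz, h1, h2]
    ring
  have hXs : ContDiff ℝ ∞ X := contDiff_polarPlane p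
  set U₀ : Set (ℝ × ℝ) := {a | 0 < a.1} ∩ X ⁻¹' V with hU₀
  have hU₀o : IsOpen U₀ :=
    (isOpen_lt continuous_const continuous_fst).inter (hV.preimage hXs.continuous)
  have hinj : Function.Injective (fderiv ℝ (fun a => proj (X a)) a₀) := by
    have hd : fderiv ℝ (fun a => proj (X a)) a₀ = proj.comp (fderiv ℝ X a₀) :=
      (proj.hasFDerivAt.comp a₀ (hXs.differentiable (by simp) a₀).hasFDerivAt).fderiv
    rw [hd, injective_iff_map_eq_zero]
    exact fun w hw => eq_zero_of_proj_fderiv_polarPlane ha₀pos hw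
  obtain ⟨e, he, hae, heU, -⟩ := exists_openPartialHomeomorph hU₀o
    (proj.contDiff.comp hXs).contDiffOn ⟨ha₀pos, by rwa [mem_preimage, hXa₀]⟩ hinj
  have heX : ∀ a, e a = proj (X a) := fun a => by rw [he]; rfl
  have hXz : ∀ a, (X a).2.2 = p.2.2 + p.2.1 * (X a).1 - p.1 * (X a).2.1 := fun a => rfl
  have hpos : ∀ a ∈ e.source, 0 < a.1 := fun a ha => (heU ha).1
  have hXS : ∀ a ∈ e.source, X a ∈ S := fun a ha => (h _ (heU ha).2).2 (hXz a)
  have hparam : IsLocalParam S e.source X := by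
    refine ⟨e.open_source, hXs.contDiffOn, fun a ha => ?_, ?_, V ∩ proj ⁻¹' e.target,
      hV.inter (e.open_target.preimage proj.continuous), ?_⟩
    · rw [injective_iff_map_eq_zero]
      intro w hw
      exact eq_zero_of_proj_fderiv_polarPlane (p := p) (hpos a ha) (by rw [← hX, hw, map_zero])
    · refine IsEmbedding.of_comp (hXs.continuous.comp continuous_subtype_val) proj.continuous ?_
      have : proj ∘ e.source.domRestrict X = e.source.domRestrict e :=
        funext fun a => (heX a.1).symm
      rw [this]
      exact e.isEmbedding_restrict
    · ext r
      constructor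
      · rintro ⟨a, ha, rfl⟩
        refine ⟨hXS a ha, (heU ha).2, ?_⟩
        rw [mem_preimage, ← heX]
        exact e.map_source ha
      · rintro ⟨hrS, hrV, hrt⟩
        refine ⟨e.symm (proj r), e.map_target hrt, ?_⟩
        have : proj (X (e.symm (proj r))) = proj r := by rw [← heX, e.right_inv hrt]
        have h1 : (X (e.symm (proj r))).1 = r.1 := congrArg (fun b : ℝ × ℝ => b.1) this
        have h2 : (X (e.symm (proj r))).2.1 = r.2.1 := congrArg (fun b : ℝ × ℝ => b.2) this
        refine Prod.ext h1 (Prod.ext h2 ?_)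
        rw [hXz, h1, h2, ← (h r hrV).1 hrS]
  -- With radius `r` as first coordinate, `X_r = e₁` and the angular derivative is `r e₂ + r² T`;
  -- hence `α = 1 / r`, and `α e₂ + T` is `α²` times it.
  have hvec : ∀ a ∈ e.source, alphaI (fun _ => 0) a • crJ (X a) (partialX X a) + reeb =
      alphaI (fun _ => 0) a ^ 2 • partialY X a := by
    intro a ha
    have := (hpos a ha).ne'
    simp only [alphaI, partialX, partialY, hX, fderiv_polarPlane, crJ, frame1, frame2, reeb,
      polarPlane]
    ext
    · simp
      field_simp
    · simp
      field_simp
    · simp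
      field_simp
      linear_combination (-a.1) * Real.sin_sq_add_cos_sq a.2
  refine ⟨e.source, X, ⟨a₀, hae, hXa₀⟩, ⟨hparam, fun a ha => ?_, fun a ha => ?_⟩, fun a ha =>
    ⟨contDiffAt_const, by simpa using (hpos a ha).ne'⟩, fun a ha => ?_, fun a ha => ?_⟩
  · simp only [contactPlane, mem_ofPred_eq, contactForm, partialX, hX, fderiv_polarPlane,
      polarPlane]
    ring
  · simp only [metric, contactForm, partialX, hX, fderiv_polarPlane, polarPlane]
    linear_combination Real.sin_sq_add_cos_sq a.2
  · rw [hvec a ha, partialY, ← map_smul]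
    exact hparam.fderiv_mem_tangentVectors ha _
  · rw [hvec a ha, smul_smul, zero_smul, zero_add]
    congr 1
    ring

/-! ### Arcs, isolated points and connected components. -/

lemma IsArcAt.exists_isPreconnected {C : Set Heis} {p : Heis} (h : IsArcAt C p) :
    ∃ W, IsOpen W ∧ p ∈ C ∩ W ∧ IsPreconnected (C ∩ W) := by
  obtain ⟨W, ε, γ, hW, hε, h0, hγ, -, -, him⟩ := h
  refine ⟨W, hW, ?_, ?_⟩
  · rw [← him]
    exact ⟨0, by simp [hε], h0⟩
  · rw [← him]
    exact isPreconnected_Ioo.image γ hγ.continuousOn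

lemma IsArcAt.not_isIsolatedSingularPoint {S : Set Heis} {p : Heis}
    (h : IsArcAt (singularSet S) p) : ¬ IsIsolatedSingularPoint S p := by
  rintro ⟨V, hV, hVp⟩
  obtain ⟨W, ε, γ, hW, hε, h0, hγ, -, hemb, him⟩ := h
  have hmem : (0 : ℝ) ∈ Ioo (-ε) ε := by simp [hε]
  have hc : ContinuousAt γ 0 := hγ.continuousOn.continuousAt (isOpen_Ioo.mem_nhds hmem)
  have hpV : γ 0 ∈ V := by
    rw [h0]
    exact (hVp.superset rfl).2
  have hev : ∀ᶠ t in 𝓝[≠] (0 : ℝ), (t ∈ Ioo (-ε) ε ∧ γ t ∈ V) ∧ t ≠ 0 :=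
    (((isOpen_Ioo.eventually_mem hmem).and
      (hc.eventually_mem (hV.mem_nhds hpV))).filter_mono nhdsWithin_le_nhds).and
      self_mem_nhdsWithin
  obtain ⟨t, ⟨ht, htV⟩, ht0⟩ := hev.exists
  have h1 : γ t = p := hVp.subset ⟨(him.subset ⟨t, ht, rfl⟩).1, htV⟩
  have h2 := hemb.injective (a₁ := ⟨t, ht⟩) (a₂ := ⟨0, hmem⟩) (h1.trans h0.symm)
  exact ht0 (congrArg Subtype.val h2)

end Heis

theorem theorem1p8 (S : Set Heis) (hS : Heis.IsPMinimal S) :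
    (∀ p ∈ Heis.singularSet S,
      (∃ W : Set Heis, IsOpen W ∧
        connectedComponentIn (Heis.singularSet S) p = Heis.singularSet S ∩ W) ∧
      (connectedComponentIn (Heis.singularSet S) p = {p} ∨
        Heis.IsC1Curve (connectedComponentIn (Heis.singularSet S) p))) ∧
    (∀ p : Heis, Heis.IsIsolatedSingularPoint S p ↔ Heis.IsPlanePieceAt S p) ∧
    (∀ p : Heis, Heis.IsIsolatedSingularPoint S p →
      ∃ (W : Set Heis) (c : ℝ), IsOpen W ∧ p ∈ W ∧
        ∀ q ∈ S ∩ W, q ≠ p → Heis.IsSpecialTypeIAt S q (fun _ => c)) := by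
  have hplane : ∀ p, Heis.IsIsolatedSingularPoint S p → ∃ V : Set Heis, IsOpen V ∧ p ∈ V ∧
      ∀ q ∈ V, q ∈ S ↔ q.2.2 = p.2.2 + p.2.1 * q.1 - p.1 * q.2.1 := by
    intro p hp
    obtain ⟨W, -, hWp⟩ := id hp
    exact (hS.isArcAt_or_plane (hWp.superset rfl).1).resolve_left
      fun h => h.not_isIsolatedSingularPoint hp
  have hdich : ∀ p ∈ Heis.singularSet S, Heis.IsArcAt (Heis.singularSet S) p ∨
      Heis.IsIsolatedSingularPoint S p := fun p hp =>
    (hS.isArcAt_or_plane hp).imp_right fun ⟨V, hV, hpV, h⟩ =>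
      (Heis.isPlanePieceAt_of_eq_affine hV hpV h).isIsolatedSingularPoint
  refine ⟨fun p hp => ?_, fun p => ⟨fun h => ?_, fun h => h.isIsolatedSingularPoint⟩, fun p h => ?_⟩
  · set C := connectedComponentIn (Heis.singularSet S) p with hC
    have hCS : C ⊆ Heis.singularSet S := connectedComponentIn_subset _ _
    have hpC : p ∈ C := mem_connectedComponentIn hp
    -- A preconnected piece of the singular set meeting `C` lies in `C`. So components are
    -- relatively open, and an arc of the singular set through a point of `C` is an arc of `C`.
    have hsub : ∀ q ∈ C, ∀ W, q ∈ Heis.singularSet S ∩ W →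
        IsPreconnected (Heis.singularSet S ∩ W) → Heis.singularSet S ∩ W ⊆ C := by
      intro q hq W hqW hW
      rw [hC, connectedComponentIn_eq hq]
      exact hW.subset_connectedComponentIn hqW inter_subset_left
    have hloc : ∀ q ∈ C, ∃ W, IsOpen W ∧ q ∈ W ∧ Heis.singularSet S ∩ W ⊆ C := by
      intro q hq
      rcases hdich q (hCS hq) with h | ⟨W, hW, hWq⟩
      · obtain ⟨W, hW, hqW, hc⟩ := h.exists_isPreconnected
        exact ⟨W, hW, hqW.2, hsub q hq W hqW hc⟩
      · exact ⟨W, hW, (hWq.superset rfl).2, by rw [hWq]; exact singleton_subset_iff.2 hq⟩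
    refine ⟨?_, ?_⟩
    · choose! O hO hqO hOC using hloc
      refine ⟨⋃ q ∈ C, O q, isOpen_biUnion hO, Subset.antisymm
        (fun q hq => ⟨hCS hq, mem_biUnion hq (hqO q hq)⟩) ?_⟩
      rintro r ⟨hr, hrO⟩
      obtain ⟨q, hq, hrq⟩ := mem_iUnion₂.1 hrO
      exact hOC q hq ⟨hr, hrq⟩
    · by_cases harc : ∀ q ∈ C, Heis.IsArcAt (Heis.singularSet S) q
      · right
        intro q hq
        obtain ⟨W, ε, γ, hW, hε, h0, hγ, hd, hemb, him⟩ := harc q hq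
        refine ⟨W, ε, γ, hW, hε, h0, hγ, hd, hemb, ?_⟩
        have hsubC := hsub q hq W (by rw [← him]; exact ⟨0, by simp [hε], h0⟩)
          (by rw [← him]; exact isPreconnected_Ioo.image γ hγ.continuousOn)
        rw [him]
        exact Subset.antisymm (fun r hr => ⟨hsubC hr, hr.2⟩) (inter_subset_inter_left W hCS)
      · left
        push Not at harc
        obtain ⟨q, hq, hqa⟩ := harc
        obtain ⟨W, hW, hWq⟩ := (hdich q (hCS hq)).resolve_left hqa
        -- Any further point of `C` would let `W` and the complement of `q` separate the connected
        -- set `C`.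
        have hCq : C ⊆ {q} := by
          intro r hr
          by_contra hne
          obtain ⟨s, hs, hsW, hsq⟩ := (isPreconnected_connectedComponentIn :
            IsPreconnected C) W {q}ᶜ hW isOpen_compl_singleton
            (fun x _ => (em (x = q)).imp (fun h => by rw [h]; exact (hWq.superset rfl).2) id)
            ⟨q, hq, (hWq.superset rfl).2⟩ ⟨r, hr, hne⟩
          exact hsq (hWq.subset ⟨hCS hs, hsW⟩)
        have hpq : p = q := hCq hpC
        exact Subset.antisymm (by rw [hpq]; exact hCq) (singleton_subset_iff.2 hpC)
  · obtain ⟨V, hV, hpV, hVS⟩ := hplane p h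
    exact Heis.isPlanePieceAt_of_eq_affine hV hpV hVS
  · obtain ⟨V, hV, hpV, hVS⟩ := hplane p h
    exact ⟨V, 0, hV, hpV, fun q hq hqp =>
      Heis.isSpecialTypeIAt_of_eq_affine hV hVS hq.2 hq.1 hqp⟩
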